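/- Let $S=\mathrm{PG}(d,\mathbb{F}_q)$ be the projective space whose points are the one-dimensional subspaces of $\mathbb{F}_q^{d+1}$, and whose lines are the sets of points contained in a fixed two-dimensional subspace. For a bijection $f$ from the points of $S$ to a set $P$, let $f(S)$ be the space on the point set $P$ whose lines are the images under $f$ of the lines of $S$; the spaces $\mathrm{PG}(d,\mathbb{F}_q)$ on $P$ are those of this form. Two such spaces on the same point set are orthogoval if each line of one meets each line of the other in at most two points. A set of spaces is mutually orthogoval if any two distinct members are orthogoval. Let $z$ be a primitive element of $\mathbb{F}_{q^{d+1}}$ (a generator of its multiplicative group), and give the point $(x_1:\dots:x_{d+1})$ of $S$ the labels $a\sum_{i=1}^{d+1} x_i z^i$ with $a\in\mathbb{F}_q^{*}$. For $m$ relatively prime to $q^{d+1}-1$, the map $x\mapsto x^m$ on labels induces a bijection $\Phi_m$ of the points of $S$. **Theorem.** There exist sets of 6 mutually orthogoval $\mathrm{PG}(4,\mathbb{F}_2)$, 18 mutually orthogoval $\mathrm{PG}(6,\mathbb{F}_2)$, 10 mutually orthogoval $\mathrm{PG}(4,\mathbb{F}_3)$, 78 mutually orthogoval $\mathrm{PG}(6,\mathbb{F}_3)$,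 3 mutually orthogoval $\mathrm{PG}(4,\mathbb{F}_4)$, 11 mutually orthogoval $\mathrm{PG}(6,\mathbb{F}_4)$, and 7 mutually orthogoval $\mathrm{PG}(4,\mathbb{F}_5)$. In each case, with $N$ the stated size, the set can be chosen of the form $\{\Phi_{w^i}(S) : 0\le i\le N-1\}$ for some primitive element $z$ and some positive integer $w$ relatively prime to $q^{d+1}-1$. -/

import Mathlib

open scoped LinearAlgebra.Projectivization

namespace Orthogoval

/-- The point set of `PG(d, F)`: the one-dimensional subspaces of `F ^ (d + 1)`. -/
abbrev PGPoint (d : ℕ) (F : Type*) [Field F] : Type _ := ℙ F (Fin (d + 1) → F)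

/-- The lines of the standard `PG(d, F)`, as sets of points: each two-dimensional subspace `W`
of `F ^ (d + 1)` gives the line of all points contained in `W`. -/
def standardLines (d : ℕ) (F : Type*) [Field F] : Set (Set (PGPoint d F)) :=
  {l | ∃ W : Submodule F (Fin (d + 1) → F), Module.finrank F W = 2 ∧
    l = {x : PGPoint d F | x.submodule ≤ W}}

/-- The line set of the space `f(PG(d, F))` that a bijection `f` from the standard point set to `P`
induces on `P`: its lines are the images under `f` of the standard lines. -/
def inducedLines {d : ℕ} {F : Type*} [Field F] {P : Type*} (f : PGPoint d F ≃ P) :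
    Set (Set P) :=
  {l | ∃ m ∈ standardLines d F, l = f '' m}

/-- `L` is the line set of a projective space isomorphic to `PG(d, F)` on the point set `P`. -/
def IsProjectiveSpace (d : ℕ) (F : Type*) [Field F] {P : Type*} (L : Set (Set P)) : Prop :=
  ∃ f : PGPoint d F ≃ P, L = inducedLines f

/-- Two spaces on the point set `P`, given by their line sets, are orthogoval: each line of
one meets each line of the other in at most two points. -/
def AreOrthogoval {P : Type*} (L M : Set (Set P)) : Prop :=
  ∀ l ∈ L, ∀ m ∈ M, (l ∩ m).encard ≤ 2

/-- `𝒮` is a set of `N` mutually orthogoval spaces `PG(d, F)` on the point set `P`. -/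
def IsMutuallyOrthogovalSet (d : ℕ) (F : Type*) [Field F] {P : Type*} (N : ℕ)
    (𝒮 : Set (Set (Set P))) : Prop :=
  𝒮.Finite ∧ 𝒮.ncard = N ∧ (∀ L ∈ 𝒮, IsProjectiveSpace d F L) ∧ 𝒮.Pairwise AreOrthogoval

/-- The label `∑ i ∈ {1, …, d + 1}, x_i z ^ i` of a coordinate vector. -/
def label {d : ℕ} {F E : Type*} [Field F] [Field E] [Algebra F E] (z : E)
    (x : Fin (d + 1) → F) : E :=
  ∑ i : Fin (d + 1), x i • z ^ ((i : ℕ) + 1)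

/-- The bijection `f` of the points of `PG(d, F)` is the map induced by `x ↦ x ^ m` on labels:
it sends the point with label `x` to the point with label `x ^ m`. -/
def IsPowerMap {d : ℕ} {F E : Type*} [Field F] [Field E] [Algebra F E] (z : E) (m : ℕ)
    (f : PGPoint d F ≃ PGPoint d F) : Prop :=
  ∀ (x y : Fin (d + 1) → F) (hx : x ≠ 0) (hy : y ≠ 0),
    label z y = label z x ^ m → f (Projectivization.mk F x hx) = Projectivization.mk F y hy

/-- `𝒮` consists of the spaces induced by the power maps with exponents
`w ^ 0, w ^ 1, …, w ^ (N - 1)`, where the points of `PG(d, F)` are labelled through some primitive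
element `z` of a field extension `E` of `F` of degree `d + 1`. -/
def IsPowerMapFamily.{u} (d : ℕ) (F : Type u) [Field F] (N w : ℕ)
    (𝒮 : Set (Set (Set (PGPoint d F)))) : Prop :=
  ∃ (E : Type u) (_ : Field E) (_ : Algebra F E) (z : E),
    Module.finrank F E = d + 1 ∧ IsPrimitiveRoot z (Nat.card E - 1) ∧
    ∃ f : Fin N → (PGPoint d F ≃ PGPoint d F),
      (∀ i : Fin N, IsPowerMap z (w ^ (i : ℕ)) (f i)) ∧
      𝒮 = Set.range fun i => inducedLines (f i)

/-- There is a set of `N` mutually orthogoval `PG(d, F)`, induced by the powers of one power map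
`Φ_w`, with `w` relatively prime to the order of the multiplicative group of the extension field of
degree `d + 1`. -/
def HasMutuallyOrthogovalPG (d : ℕ) (F : Type*) [Field F] (N : ℕ) : Prop :=
  ∃ 𝒮 : Set (Set (Set (PGPoint d F))), IsMutuallyOrthogovalSet d F N 𝒮 ∧
    ∃ w : ℕ, w.Coprime (Nat.card F ^ (d + 1) - 1) ∧ IsPowerMapFamily d F N w 𝒮

end Orthogoval

/-! Labels identify the points of `PG(d, q)` with `E*/F*`, where `E` is the extension of degree
`d + 1` of `F = 𝔽_q`. Since `Φ_{w ^ i}` is the `i`-th iterate of `Φ_w`, it suffices to compare `S`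
with `Φ_{w ^ k}(S)` for `0 < k < N`. Up to multiplication in `E*`, which preserves both spaces,
three collinear points of `S` have the labels `1`, `y` and `1 + y`, so the two spaces are orthogoval
as soon as `(1 + y) ^ n`, with `n = w ^ k`, is never in the span of `1` and `y ^ n` for `y ∉ F`; the
spaces are then distinct because a line has more than two points. The Frobenius map preserves this
condition, so one `y` in each of its orbits is enough. In terms of Zech logarithms, given by
`1 + z ^ t = z ^ Z t`, the condition is a finite computation modulo `|E| - 1`, which the kernel
carries out. -/

namespace Orthogoval

section Collinearity

variable {F V : Type*} [Field F] [AddCommGroup V] [Module F V]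

theorem linearIndependent_pair_iff_mk_ne {u v : V} (hu : u ≠ 0) (hv : v ≠ 0) :
    LinearIndependent F ![u, v] ↔ Projectivization.mk F u hu ≠ Projectivization.mk F v hv := by
  rw [LinearIndependent.pair_symm_iff, LinearIndependent.pair_iff' hv, ne_eq,
    Projectivization.mk_eq_mk_iff', not_exists]

theorem mem_span_pair_of_finrank_eq_two {W : Submodule F V} (hW : Module.finrank F W = 2)
    {u v w : V} (hu : u ∈ W) (hv : v ∈ W) (hw : w ∈ W) (huv : LinearIndependent F ![u, v]) :
    w ∈ Submodule.span F {u, v} := by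
  have : FiniteDimensional F W := Module.finite_of_finrank_eq_succ hW
  have hspan := finrank_span_eq_card huv
  rw [Matrix.range_cons_cons_empty, Fintype.card_fin] at hspan
  rwa [Submodule.eq_of_le_of_finrank_eq (Submodule.span_le.2 (Set.pair_subset hu hv))
    (hspan.trans hW.symm)]

theorem exists_eq_mk_add_of_collinear {W : Submodule F V} (hW : Module.finrank F W = 2)
    {P Q R : ℙ F V} (hP : P.submodule ≤ W) (hQ : Q.submodule ≤ W) (hR : R.submodule ≤ W)
    (hPQ : P ≠ Q) (hPR : P ≠ R) (hQR : Q ≠ R) :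
    ∃ (u v : V) (hu : u ≠ 0) (hv : v ≠ 0) (huv : u + v ≠ 0), P = Projectivization.mk F u hu ∧
      Q = Projectivization.mk F v hv ∧ R = Projectivization.mk F (u + v) huv := by
  induction P with | _ u hu
  induction Q with | _ v hv
  induction R with | _ w hw
  simp only [Projectivization.submodule_mk, Submodule.span_singleton_le_iff_mem] at hP hQ hR
  obtain ⟨a, b, rfl⟩ := Submodule.mem_span_pair.1 (mem_span_pair_of_finrank_eq_two hW hP hQ hR
    ((linearIndependent_pair_iff_mk_ne hu hv).2 hPQ))
  have ha : a ≠ 0 := by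
    rintro rfl
    exact hQR.symm ((Projectivization.mk_eq_mk_iff' ..).2 ⟨b, by simp⟩)
  have hb : b ≠ 0 := by
    rintro rfl
    exact hPR.symm ((Projectivization.mk_eq_mk_iff' ..).2 ⟨a, by simp⟩)
  exact ⟨a • u, b • v, smul_ne_zero ha hu, smul_ne_zero hb hv, hw,
    ((Projectivization.mk_eq_mk_iff' ..).2 ⟨a, rfl⟩).symm,
    ((Projectivization.mk_eq_mk_iff' ..).2 ⟨b, rfl⟩).symm, rfl⟩

end Collinearity

theorem two_lt_encard_iff {α : Type*} {s : Set α} :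
    2 < s.encard ↔ ∃ a ∈ s, ∃ b ∈ s, ∃ c ∈ s, a ≠ b ∧ a ≠ c ∧ b ≠ c := by
  rw [← ENat.add_one_le_iff (by simp), show (2 + 1 : ℕ∞) = 3 from rfl]
  constructor
  · intro h
    obtain ⟨t, hts, ht⟩ := Set.exists_subset_encard_eq h
    obtain ⟨a, b, c, hab, hac, hbc, rfl⟩ := Set.encard_eq_three.1 ht
    exact ⟨a, hts (by simp), b, hts (by simp), c, hts (by simp), hab, hac, hbc⟩
  · rintro ⟨a, ha, b, hb, c, hc, hab, hac, hbc⟩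
    rw [← Set.encard_eq_three.2 ⟨a, b, c, hab, hac, hbc, rfl⟩]
    exact Set.encard_le_encard (by simp [Set.insert_subset_iff, ha, hb, hc])

theorem AreOrthogoval.symm {P : Type*} {L M : Set (Set P)} (h : AreOrthogoval L M) :
    AreOrthogoval M L :=
  fun l hl m hm => Set.inter_comm m l ▸ h m hm l hl

theorem AreOrthogoval.image {P Q : Type*} {L M : Set (Set P)} (h : AreOrthogoval L M) {f : P → Q}
    (hf : f.Injective) : AreOrthogoval ((f '' ·) '' L) ((f '' ·) '' M) := by
  rintro _ ⟨l, hl, rfl⟩ _ ⟨m, hm, rfl⟩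
  rw [← Set.image_inter hf, hf.encard_image]
  exact h l hl m hm

section LineSets

variable {d : ℕ} {F : Type*} [Field F]

theorem exists_mem_standardLines_two_lt_encard (hd : 0 < d) :
    ∃ l ∈ standardLines d F, 2 < l.encard := by
  obtain ⟨u, hu⟩ := exists_ne (0 : Fin (d + 1) → F)
  obtain ⟨v, huv⟩ := exists_linearIndependent_pair_of_one_lt_finrank
    (by rw [Module.finrank_fin_fun]; omega) hu
  have hv : v ≠ 0 := by simpa using huv.ne_zero 1
  have huw : LinearIndependent F ![u, u + v] := by simpa using huv
  have hvw : LinearIndependent F ![v, u + v] := by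
    simpa [add_comm u] using LinearIndependent.pair_symm_iff.1 huv
  have hw : u + v ≠ 0 := by simpa using huw.ne_zero 1
  have hmem (w : Fin (d + 1) → F) (hw : w ≠ 0) (h : w ∈ Submodule.span F {u, v}) :
      (Projectivization.mk F w hw).submodule ≤ Submodule.span F {u, v} := by
    rwa [Projectivization.submodule_mk, Submodule.span_singleton_le_iff_mem]
  refine ⟨_, ⟨Submodule.span F {u, v}, ?_, rfl⟩, two_lt_encard_iff.2
    ⟨_, hmem u hu ?_, _, hmem v hv ?_, _, hmem (u + v) hw ?_,
      (linearIndependent_pair_iff_mk_ne hu hv).1 huv,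
      (linearIndependent_pair_iff_mk_ne hu hw).1 huw,
      (linearIndependent_pair_iff_mk_ne hv hw).1 hvw⟩⟩
  · rw [← Matrix.range_cons_cons_empty u v, finrank_span_eq_card huv, Fintype.card_fin]
  · exact Submodule.mem_span_of_mem (by simp)
  · exact Submodule.mem_span_of_mem (by simp)
  · exact add_mem (Submodule.mem_span_of_mem (by simp)) (Submodule.mem_span_of_mem (by simp))

theorem not_areOrthogoval_inducedLines_self (hd : 0 < d) {P : Type*} (f : PGPoint d F ≃ P) :
    ¬ AreOrthogoval (inducedLines f) (inducedLines f) := by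
  obtain ⟨l, hl, h⟩ := exists_mem_standardLines_two_lt_encard (F := F) hd
  intro horth
  refine (horth (f '' l) ⟨l, hl, rfl⟩ _ ⟨l, hl, rfl⟩).not_gt ?_
  rwa [Set.inter_self, f.injective.encard_image]

theorem inducedLines_one : inducedLines (1 : Equiv.Perm (PGPoint d F)) = standardLines d F := by
  simp [inducedLines]

theorem inducedLines_mul (f g : Equiv.Perm (PGPoint d F)) :
    inducedLines (f * g) = (f '' ·) '' inducedLines g := by
  ext l
  simp only [inducedLines, Equiv.Perm.coe_mul, Set.image_comp, Set.mem_ofPred_eq, Set.mem_image]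
  aesop

theorem areOrthogoval_inducedLines_pow {g : Equiv.Perm (PGPoint d F)} {N i j : ℕ}
    (h : ∀ k, 0 < k → k < N → AreOrthogoval (standardLines d F) (inducedLines (g ^ k)))
    (hij : i < j) (hj : j < N) :
    AreOrthogoval (inducedLines (g ^ i)) (inducedLines (g ^ j)) := by
  obtain ⟨k, rfl⟩ := Nat.exists_eq_add_of_le hij.le
  have hk := (h k (by omega) (by omega)).image (g ^ i).injective
  rwa [← inducedLines_one, ← inducedLines_mul, ← inducedLines_mul, mul_one, ← pow_add] at hk

theorem isMutuallyOrthogovalSet_range_pow (hd : 0 < d) {g : Equiv.Perm (PGPoint d F)} {N : ℕ}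
    (h : ∀ k, 0 < k → k < N → AreOrthogoval (standardLines d F) (inducedLines (g ^ k))) :
    IsMutuallyOrthogovalSet d F N
      (Set.range fun i : Fin N => inducedLines (g ^ (i : ℕ))) := by
  have horth (i j : Fin N) (hij : i ≠ j) :
      AreOrthogoval (inducedLines (g ^ (i : ℕ))) (inducedLines (g ^ (j : ℕ))) := by
    rcases lt_or_gt_of_ne hij with hlt | hgt
    · exact areOrthogoval_inducedLines_pow h hlt j.isLt
    · exact (areOrthogoval_inducedLines_pow h hgt i.isLt).symm
  have hinj : (fun i : Fin N => inducedLines (g ^ (i : ℕ))).Injective := by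
    intro i j (hij : inducedLines _ = inducedLines _)
    by_contra hne
    exact not_areOrthogoval_inducedLines_self hd _ (hij ▸ horth i j hne)
  refine ⟨Set.finite_range _, ?_, ?_, ?_⟩
  · rw [← Nat.card_coe_set_eq, Nat.card_range_of_injective hinj, Nat.card_fin]
  · rintro _ ⟨i, rfl⟩
    exact ⟨g ^ (i : ℕ), rfl⟩
  · rintro _ ⟨i, rfl⟩ _ ⟨j, rfl⟩ hne
    exact horth i j fun hij => hne (hij ▸ rfl)

end LineSets

section PowerMaps

variable {F E : Type*} [Field F] [Field E] [Algebra F E]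

theorem pow_card_sub_one_eq_one [Finite E] {x : E} (hx : x ≠ 0) : x ^ (Nat.card E - 1) = 1 := by
  have := Fintype.ofFinite E
  rw [Nat.card_eq_fintype_card, FiniteField.pow_card_sub_one_eq_one x hx]

theorem card_sub_one_pos [Finite E] : 0 < Nat.card E - 1 :=
  Nat.sub_pos_of_lt Finite.one_lt_card

theorem exists_lt_pow_eq_of_isPrimitiveRoot [Finite E] {z : E}
    (hz : IsPrimitiveRoot z (Nat.card E - 1)) {x : E} (hx : x ≠ 0) :
    ∃ t < Nat.card E - 1, z ^ t = x :=
  have : NeZero (Nat.card E - 1) := ⟨card_sub_one_pos.ne'⟩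
  hz.eq_pow_of_pow_eq_one (pow_card_sub_one_eq_one hx)

theorem mem_fieldRange_of_pow_mem [Finite E] {n : ℕ} (hn : n.Coprime (Nat.card E - 1))
    {x : E} (h : x ^ n ∈ (algebraMap F E).fieldRange) : x ∈ (algebraMap F E).fieldRange := by
  rcases eq_or_ne x 0 with rfl | hx
  · exact zero_mem _
  · obtain ⟨k, hk⟩ := exists_pow_eq_self_of_coprime
      (hn.coprime_dvd_right (orderOf_dvd_of_pow_eq_one (pow_card_sub_one_eq_one hx)))
    exact hk ▸ pow_mem h k

theorem linearIndependent_pow_succ [Finite E] {d : ℕ} {z : E}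
    (hz : IsPrimitiveRoot z (Nat.card E - 1)) (hd : Module.finrank F E = d + 1) :
    LinearIndependent F fun i : Fin (d + 1) => z ^ ((i : ℕ) + 1) := by
  have : FiniteDimensional F E := Module.finite_of_finrank_eq_succ hd
  have hz0 : z ≠ 0 := hz.ne_zero card_sub_one_pos.ne'
  have htop : IntermediateField.adjoin F {z} = ⊤ := by
    refine eq_top_iff.2 fun y _ => ?_
    rcases eq_or_ne y 0 with rfl | hy
    · exact zero_mem _
    · obtain ⟨t, -, rfl⟩ := exists_lt_pow_eq_of_isPrimitiveRoot hz hy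
      exact pow_mem (IntermediateField.mem_adjoin_simple_self F z) t
  have hpow := linearIndependent_pow (K := F) z
  rw [(Field.primitive_element_iff_minpoly_natDegree_eq F z).1 htop, hd] at hpow
  have hmul := hpow.map' (LinearMap.mulLeft F z)
    (LinearMap.ker_eq_bot.2 (mul_right_injective₀ hz0))
  simpa only [Function.comp_def, LinearMap.mulLeft_apply, ← pow_succ'] using hmul

theorem exists_linearEquiv_eq_label [Finite E] {d : ℕ} {z : E}
    (hz : IsPrimitiveRoot z (Nat.card E - 1)) (hd : Module.finrank F E = d + 1) :
    ∃ e : (Fin (d + 1) → F) ≃ₗ[F] E, ⇑e = label z := by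
  let b := basisOfLinearIndependentOfCardEqFinrank (linearIndependent_pow_succ hz hd)
    (by rw [Fintype.card_fin, hd])
  refine ⟨b.equivFun.symm, funext fun x => ?_⟩
  simp [b, label, Module.Basis.equivFun_symm_apply]

/-- The map induced by `x ↦ x ^ n` on the points of the projective space of the extension field
`E` of `F`. -/
def powMap (F : Type*) {E : Type*} [Field F] [Field E] [Algebra F E] (n : ℕ) : ℙ F E → ℙ F E :=
  Projectivization.lift (fun x => Projectivization.mk F ((x : E) ^ n) (pow_ne_zero n x.2))
    fun x y c hxy => (Projectivization.mk_eq_mk_iff' ..).2 ⟨c ^ n, by rw [hxy, smul_pow]⟩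

theorem powMap_mk (n : ℕ) {x : E} (hx : x ≠ 0) :
    powMap F n (Projectivization.mk F x hx) = Projectivization.mk F (x ^ n) (pow_ne_zero n hx) :=
  Projectivization.lift_mk _ _ x hx

theorem mk_eq_mk_iff_div_mem_fieldRange {x y : E} (hx : x ≠ 0) (hy : y ≠ 0) :
    Projectivization.mk F x hx = Projectivization.mk F y hy ↔
      x / y ∈ (algebraMap F E).fieldRange := by
  simp only [Projectivization.mk_eq_mk_iff', RingHom.mem_fieldRange, eq_div_iff hy,
    Algebra.smul_def]

theorem powMap_injective [Finite E] {n : ℕ} (hn : n.Coprime (Nat.card E - 1)) :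
    (powMap F (E := E) n).Injective := by
  intro P Q h
  induction P with | _ x hx
  induction Q with | _ y hy
  rw [powMap_mk, powMap_mk, mk_eq_mk_iff_div_mem_fieldRange, ← div_pow] at h
  exact (mk_eq_mk_iff_div_mem_fieldRange hx hy).2 (mem_fieldRange_of_pow_mem hn h)

theorem exists_isPowerMap [Finite E] {d n : ℕ} {z : E}
    (hz : IsPrimitiveRoot z (Nat.card E - 1)) (hd : Module.finrank F E = d + 1)
    (hn : n.Coprime (Nat.card E - 1)) :
    ∃ f : Equiv.Perm (PGPoint d F), IsPowerMap z n f := by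
  obtain ⟨e, he⟩ := exists_linearEquiv_eq_label hz hd
  let φ : PGPoint d F → ℙ F E := Projectivization.map e.toLinearMap e.injective
  let ψ : ℙ F E → PGPoint d F := Projectivization.map e.symm.toLinearMap e.symm.injective
  have hinj : (ψ ∘ powMap F n ∘ φ).Injective :=
    (Projectivization.map_injective ..).comp
      ((powMap_injective hn).comp (Projectivization.map_injective ..))
  have : Finite F := Finite.of_injective _ (algebraMap F E).injective
  refine ⟨Equiv.ofBijective _ (Finite.injective_iff_bijective.1 hinj), fun x y hx hy hxy => ?_⟩
  have hsymm : e.symm (e x ^ n) = y := e.symm_apply_eq.2 (by rw [he, hxy])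
  simp [φ, ψ, Projectivization.map_mk, powMap_mk, hsymm]

theorem IsPowerMap.pow {d n : ℕ} {z : E} {f : Equiv.Perm (PGPoint d F)} (hf : IsPowerMap z n f)
    {e : (Fin (d + 1) → F) ≃ₗ[F] E} (he : ⇑e = label z) (i : ℕ) :
    IsPowerMap z (n ^ i) (f ^ i) := by
  induction i with
  | zero =>
    intro x y hx hy hxy
    rw [← he, pow_zero, pow_one, e.injective.eq_iff] at hxy
    simp [hxy]
  | succ i ih =>
    intro x y hx hy hxy
    have hpow : e (e.symm (e x ^ n ^ i)) = e x ^ n ^ i := e.apply_symm_apply _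
    have hne : e.symm (e x ^ n ^ i) ≠ 0 := by simp [hx]
    rw [pow_succ' f, Equiv.Perm.mul_apply, ih x _ hx hne (he ▸ hpow)]
    refine hf _ _ _ _ ?_
    rw [hxy, ← he, hpow, pow_succ, pow_mul]

/-- The power map with exponent `n` sends each line of the projective space of `E` over `F` to an
arc, i.e. no three points of a line are mapped to points of a line. -/
def IsArcExponent (F E : Type*) [Field F] [Field E] [Algebra F E] (n : ℕ) : Prop :=
  ∀ x y : E, LinearIndependent F ![x, y] → (x + y) ^ n ∉ Submodule.span F {x ^ n, y ^ n}

theorem IsPowerMap.areOrthogoval {d n : ℕ} {z : E} {f : Equiv.Perm (PGPoint d F)}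
    (hf : IsPowerMap z n f) {e : (Fin (d + 1) → F) ≃ₗ[F] E} (he : ⇑e = label z)
    (hn : IsArcExponent F E n) : AreOrthogoval (standardLines d F) (inducedLines f) := by
  have hne {x : Fin (d + 1) → F} (hx : x ≠ 0) : e.symm (e x ^ n) ≠ 0 := by
    simp [hx]
  have hf' {x : Fin (d + 1) → F} (hx : x ≠ 0) : f (Projectivization.mk F x hx) =
      Projectivization.mk F (e.symm (e x ^ n)) (hne hx) :=
    hf _ _ _ _ (by rw [← he, e.apply_symm_apply])
  rintro _ ⟨W, hW, rfl⟩ _ ⟨_, ⟨W', hW', rfl⟩, rfl⟩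
  by_contra! h
  obtain ⟨_, ⟨hPW, P, hP, rfl⟩, _, ⟨hQW, Q, hQ, rfl⟩, _, ⟨hRW, R, hR, rfl⟩, hPQ, hPR, hQR⟩ :=
    two_lt_encard_iff.1 h
  obtain ⟨x, y, hx, hy, hxy, rfl, rfl, rfl⟩ := exists_eq_mk_add_of_collinear hW' hP hQ hR
    (ne_of_apply_ne f hPQ) (ne_of_apply_ne f hPR) (ne_of_apply_ne f hQR)
  have hxy' : LinearIndependent F ![e x, e y] := by
    have := (linearIndependent_pair_iff_mk_ne hx hy).2 (ne_of_apply_ne f hPQ)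
    rwa [← e.toLinearMap.linearIndependent_iff e.ker, ← FinVec.map_eq] at this
  rw [hf' hx, hf' hy, ← linearIndependent_pair_iff_mk_ne] at hPQ
  simp only [Set.mem_ofPred_eq, hf', Projectivization.submodule_mk,
    Submodule.span_singleton_le_iff_mem] at hPW hQW hRW
  have hspan := Submodule.mem_map_of_mem (f := e.toLinearMap)
    (mem_span_pair_of_finrank_eq_two hW hPW hQW hRW hPQ)
  refine hn _ _ hxy' ?_
  simpa [Submodule.map_span, Set.image_pair] using hspan

theorem hasMutuallyOrthogovalPG_of_isArcExponent.{u} {d N w : ℕ} (hd : 0 < d) {F E : Type u}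
    [Field F] [Field E] [Algebra F E] [Finite E] {z : E}
    (hz : IsPrimitiveRoot z (Nat.card E - 1)) (hE : Module.finrank F E = d + 1)
    (hw : w.Coprime (Nat.card E - 1)) (h : ∀ k, 0 < k → k < N → IsArcExponent F E (w ^ k)) :
    HasMutuallyOrthogovalPG d F N := by
  obtain ⟨e, he⟩ := exists_linearEquiv_eq_label hz hE
  obtain ⟨f, hf⟩ := exists_isPowerMap hz hE hw
  have hpow (i : ℕ) : IsPowerMap z (w ^ i) (f ^ i) := hf.pow he i
  rw [Module.natCard_eq_pow_finrank (K := F), hE] at hw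
  exact ⟨_, isMutuallyOrthogovalSet_range_pow hd fun k hk hkN =>
    (hpow k).areOrthogoval he (h k hk hkN), w, hw, E, _, _, z, hE, hz, _, fun i => hpow i, rfl⟩

end PowerMaps

section ArcExponents

variable {F E : Type*} [Field F] [Field E] [Algebra F E] {n : ℕ}

theorem isArcExponent_of_one_add
    (h : ∀ y : E, y ∉ (algebraMap F E).fieldRange → (1 + y) ^ n ∉ Submodule.span F {1, y ^ n}) :
    IsArcExponent F E n := by
  intro x y hxy hmem
  have hx : x ≠ 0 := by simpa using hxy.ne_zero 0
  have hy : y ≠ 0 := by simpa using hxy.ne_zero 1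
  have hyx : y / x ∉ (algebraMap F E).fieldRange := by
    rw [← mk_eq_mk_iff_div_mem_fieldRange hy hx]
    exact ((linearIndependent_pair_iff_mk_ne hx hy).1 hxy).symm
  refine h (y / x) hyx ?_
  obtain ⟨a, b, hab⟩ := Submodule.mem_span_pair.1 hmem
  refine Submodule.mem_span_pair.2 ⟨a, b, ?_⟩
  have hxn : x ^ n ≠ 0 := pow_ne_zero n hx
  rw [one_add_div hx, div_pow, div_pow, ← hab, add_div, smul_div_assoc, smul_div_assoc,
    div_self hxn]

theorem one_add_pow_char_pow_mem_span {p : ℕ} [Fact p.Prime] [CharP E p] {y : E}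
    (h : (1 + y) ^ n ∈ Submodule.span F {1, y ^ n}) (j : ℕ) :
    (1 + y ^ p ^ j) ^ n ∈ Submodule.span F {1, (y ^ p ^ j) ^ n} := by
  obtain ⟨a, b, hab⟩ := Submodule.mem_span_pair.1 h
  refine Submodule.mem_span_pair.2 ⟨a ^ p ^ j, b ^ p ^ j, ?_⟩
  calc a ^ p ^ j • (1 : E) + b ^ p ^ j • (y ^ p ^ j) ^ n
      = (a • 1 + b • y ^ n) ^ p ^ j := by
        rw [add_pow_char_pow, smul_pow, smul_pow, one_pow, pow_right_comm]
    _ = (1 + y ^ p ^ j) ^ n := by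
        rw [hab, pow_right_comm, add_pow_char_pow, one_pow]

theorem one_add_pow_notMem_span [Finite E] (hn : n.Coprime (Nat.card E - 1)) {y : E}
    (hy : y ∉ (algebraMap F E).fieldRange)
    (h : ∀ a b : F, a ≠ 0 → b ≠ 0 → (1 + y) ^ n ≠ algebraMap F E a + algebraMap F E b * y ^ n) :
    (1 + y) ^ n ∉ Submodule.span F {1, y ^ n} := by
  intro hmem
  obtain ⟨a, b, hab⟩ := Submodule.mem_span_pair.1 hmem
  rw [← Algebra.algebraMap_eq_smul_one, Algebra.smul_def] at hab
  have hy0 : y ≠ 0 := by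
    rintro rfl
    exact hy (zero_mem _)
  refine h a b ?_ ?_ hab.symm
  · rintro rfl
    have hdiv : (1 + y) / y ∈ (algebraMap F E).fieldRange := by
      refine mem_fieldRange_of_pow_mem hn ⟨b, ?_⟩
      rw [div_pow, eq_div_iff (pow_ne_zero n hy0), ← hab, map_zero, zero_add]
    rw [add_div, div_self hy0, one_div] at hdiv
    exact hy (inv_mem_iff.1 (by simpa using sub_mem hdiv (one_mem _)))
  · rintro rfl
    have hadd : 1 + y ∈ (algebraMap F E).fieldRange :=
      mem_fieldRange_of_pow_mem hn ⟨a, by rw [← hab, map_zero, zero_mul, add_zero]⟩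
    exact hy (by simpa using sub_mem hadd (one_mem _))

theorem coprime_char_card_sub_one [Finite E] (p : ℕ) [Fact p.Prime] [CharP E p] :
    p.Coprime (Nat.card E - 1) := by
  have := Fintype.ofFinite E
  have hdvd : p ∣ Nat.card E := by
    rw [← CharP.cast_eq_zero_iff E p, Nat.card_eq_fintype_card, FiniteField.cast_card_eq_zero]
  refine Nat.Coprime.coprime_dvd_left hdvd ?_
  rw [Nat.coprime_self_sub_right Finite.card_pos]
  simp

theorem isArcExponent_of_minimal_in_orbit [Finite E] {z : E}
    (hz : IsPrimitiveRoot z (Nat.card E - 1)) (p : ℕ) [Fact p.Prime] [CharP E p]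
    (h : ∀ t < Nat.card E - 1, z ^ t ∉ (algebraMap F E).fieldRange →
      (∀ j, t ≤ p ^ j * t % (Nat.card E - 1)) →
      (1 + z ^ t) ^ n ∉ Submodule.span F {1, (z ^ t) ^ n}) :
    IsArcExponent F E n := by
  classical
  refine isArcExponent_of_one_add fun y hy hmem => ?_
  have hz' (t : ℕ) : z ^ (t % (Nat.card E - 1)) = z ^ t :=
    (pow_eq_pow_mod t hz.pow_eq_one).symm
  have hex : ∃ t, z ^ t ∉ (algebraMap F E).fieldRange ∧
      (1 + z ^ t) ^ n ∈ Submodule.span F {1, (z ^ t) ^ n} := by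
    obtain ⟨t, -, rfl⟩ := exists_lt_pow_eq_of_isPrimitiveRoot hz
      (ne_of_mem_of_not_mem (zero_mem _) hy).symm
    exact ⟨t, hy, hmem⟩
  obtain ⟨hrange, hspan⟩ := Nat.find_spec hex
  refine h (Nat.find hex) ?_ hrange (fun j => Nat.find_min' hex ?_) hspan
  · refine (Nat.find_min' hex ?_).trans_lt (Nat.mod_lt (Nat.find hex) card_sub_one_pos)
    rw [hz']
    exact ⟨hrange, hspan⟩
  · rw [hz', mul_comm, pow_mul]
    exact ⟨fun hmem => hrange (mem_fieldRange_of_pow_mem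
      ((coprime_char_card_sub_one p).pow_left j) hmem), one_add_pow_char_pow_mem_span hspan j⟩

end ArcExponents

section KernelEvaluation

/-- `f a`, written so that the kernel evaluates the numeral `a` before it unfolds `f`. -/
def force {α : Type} (a : ℕ) (f : ℕ → α) : α :=
  Nat.rec (motive := fun _ => α) (f 0) (fun b _ => f b) (a + 1)

theorem force_eq {α : Type} (a : ℕ) (f : ℕ → α) : force a f = f a := rfl

/-- The test that `P t` holds for all `lo ≤ t < lo + 2 ^ k`; halving the interval keeps the
recursion depth logarithmic. -/
def allBlock (P : ℕ → Bool) : ℕ → ℕ → Bool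
  | 0, lo => P lo
  | k + 1, lo => allBlock P k lo && force (lo + 2 ^ k) (allBlock P k)

theorem forall_of_allBlock {P : ℕ → Bool} {k lo t : ℕ} (h : allBlock P k lo = true)
    (hlo : lo ≤ t) (ht : t < lo + 2 ^ k) : P t = true := by
  induction k generalizing lo with
  | zero =>
    obtain rfl : t = lo := by omega
    exact h
  | succ k ih =>
    rw [allBlock, force_eq, Bool.and_eq_true] at h
    rcases lt_or_ge t (lo + 2 ^ k) with hlt | hge
    · exact ih h.1 hlo hlt
    · exact ih h.2 hge (by omega)

end KernelEvaluation

section ZechLogarithms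

/-- The numerical test that `z ^ b` is no combination `c₁ + c₂ z ^ a` with nonzero coefficients in
the field of order `r + 1`, for a primitive element `z` of order `m` with Zech logarithm `Z`. -/
def checkTriple (m r : ℕ) (Z : ℕ → ℕ) (a b : ℕ) : Bool :=
  force (m / r) fun N => force (b % N) fun b =>
    (List.range r).all fun i => Z ((a + i * N) % m) % N != b

/-- `checkTriple` for the exponents `w ^ i * a` and `w ^ i * b` with `1 ≤ i ≤ n`. -/
def checkPowers (m r w : ℕ) (Z : ℕ → ℕ) : ℕ → ℕ → ℕ → Bool
  | 0, _, _ => true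
  | n + 1, a, b => force (w * a % m) fun a' => force (w * b % m) fun b' =>
      checkTriple m r Z a' b' && checkPowers m r w Z n a' b'

theorem checkTriple_of_checkPowers {m r w n a b i : ℕ} {Z : ℕ → ℕ}
    (h : checkPowers m r w Z n a b = true) (hi : i < n) :
    checkTriple m r Z (w ^ (i + 1) * a % m) (w ^ (i + 1) * b % m) = true := by
  induction n generalizing a b i with
  | zero => omega
  | succ n ih =>
    simp only [checkPowers, force_eq, Bool.and_eq_true] at h
    cases i with
    | zero => simpa using h.1
    | succ i => simpa [pow_succ w (i + 1), mul_assoc] using ih h.2 (Nat.lt_of_succ_lt_succ hi)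

/-- The test that `t ≤ p ^ j * s % m` for `1 ≤ j ≤ n`. -/
def isOrbitMin (p m t : ℕ) : ℕ → ℕ → Bool
  | 0, _ => true
  | n + 1, s => force (p * s % m) fun s' => t ≤ s' && isOrbitMin p m t n s'

theorem isOrbitMin_eq_true {p m t s n : ℕ} (h : ∀ j, t ≤ p ^ j * s % m) :
    isOrbitMin p m t n s = true := by
  induction n generalizing s with
  | zero => rfl
  | succ n ih =>
    simp only [isOrbitMin, force_eq, Bool.and_eq_true, decide_eq_true_eq]
    refine ⟨by simpa using h 1, ih fun j => ?_⟩
    simpa [pow_succ, mul_assoc] using h (j + 1)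

/-- The test that the powers `w ^ i` with `1 ≤ i ≤ n` are arc exponents, carried out for one
representative `t` of each orbit of multiplication by the characteristic `p`. -/
def checkExponent (p e m r w n k : ℕ) (Z : ℕ → ℕ) : Bool :=
  allBlock (fun t => m ≤ t || t % (m / r) == 0 || !isOrbitMin p m t e t ||
    checkPowers m r w Z n t (Z t)) k 0

/-- `Z` is a Zech logarithm to the base of the primitive element `z`. -/
structure IsZechLog {E : Type*} [Field E] (z : E) (Z : ℕ → ℕ) : Prop where
  isPrimitiveRoot : IsPrimitiveRoot z (Nat.card E - 1)
  one_add_pow : ∀ t < Nat.card E - 1, 1 + z ^ t = 0 ∨ 1 + z ^ t = z ^ Z t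

variable {F E : Type*} [Field F] [Field E] [Algebra F E]

theorem card_sub_one_dvd_card_sub_one [Finite E] : Nat.card F - 1 ∣ Nat.card E - 1 := by
  rw [Module.natCard_eq_pow_finrank (K := F) (V := E)]
  exact Nat.sub_one_dvd_pow_sub_one _ _

theorem isPrimitiveRoot_pow_card_div [Finite E] {z : E} (hz : IsPrimitiveRoot z (Nat.card E - 1)) :
    IsPrimitiveRoot (z ^ ((Nat.card E - 1) / (Nat.card F - 1))) (Nat.card F - 1) :=
  hz.pow card_sub_one_pos (Nat.div_mul_cancel card_sub_one_dvd_card_sub_one).symm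

open Polynomial in
theorem splits_X_pow_card_sub_X (F : Type*) [Field F] [Finite F] :
    (X ^ Nat.card F - X : F[X]).Splits := by
  have := Fintype.ofFinite F
  simpa [Nat.card_eq_fintype_card] using (FiniteField.isSplittingField_sub F F).splits

theorem mem_fieldRange_of_pow_card_eq_self [Finite F] {y : E} (hy : y ^ Nat.card F = y) :
    y ∈ (algebraMap F E).fieldRange :=
  (splits_X_pow_card_sub_X F).mem_range_of_isRoot
    (FiniteField.X_pow_card_sub_X_ne_zero F Finite.one_lt_card) (by simp [hy])

theorem pow_mem_fieldRange_of_dvd [Finite E] {z : E} (hz : IsPrimitiveRoot z (Nat.card E - 1))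
    {t : ℕ} (ht : (Nat.card E - 1) / (Nat.card F - 1) ∣ t) :
    z ^ t ∈ (algebraMap F E).fieldRange := by
  have : Finite F := Finite.of_injective _ (algebraMap F E).injective
  obtain ⟨s, rfl⟩ := ht
  refine mem_fieldRange_of_pow_card_eq_self ?_
  rw [← pow_sub_one_mul Finite.card_pos.ne', pow_mul, pow_right_comm,
    (isPrimitiveRoot_pow_card_div hz).pow_eq_one, one_pow, one_mul]

theorem exists_lt_pow_eq_algebraMap [Finite E] {z : E} (hz : IsPrimitiveRoot z (Nat.card E - 1))
    {c : F} (hc : c ≠ 0) :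
    ∃ i < Nat.card F - 1, z ^ (i * ((Nat.card E - 1) / (Nat.card F - 1))) = algebraMap F E c := by
  have : Finite F := Finite.of_injective _ (algebraMap F E).injective
  have : NeZero (Nat.card F - 1) := ⟨card_sub_one_pos.ne'⟩
  simp only [mul_comm _ ((Nat.card E - 1) / (Nat.card F - 1)), pow_mul]
  refine (isPrimitiveRoot_pow_card_div hz).eq_pow_of_pow_eq_one ?_
  rw [← map_pow, pow_card_sub_one_eq_one hc, map_one]

namespace IsZechLog

variable {z : E} {Z : ℕ → ℕ}

theorem pow_mod (hZ : IsZechLog z Z) (t : ℕ) : z ^ (t % (Nat.card E - 1)) = z ^ t :=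
  (pow_eq_pow_mod t hZ.isPrimitiveRoot.pow_eq_one).symm

variable [Finite E]

theorem modEq_of_pow_eq_pow (hZ : IsZechLog z Z) {s t : ℕ} (h : z ^ s = z ^ t) :
    s ≡ t [MOD (Nat.card E - 1)] := by
  rw [← hZ.pow_mod s, ← hZ.pow_mod t] at h
  exact hZ.isPrimitiveRoot.pow_inj (Nat.mod_lt _ card_sub_one_pos) (Nat.mod_lt _ card_sub_one_pos) h

theorem pow_ne_of_checkTriple (hZ : IsZechLog z Z) {a b : ℕ}
    (h : checkTriple (Nat.card E - 1) (Nat.card F - 1) Z a b = true) {c₁ c₂ : F} (hc₁ : c₁ ≠ 0)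
    (hc₂ : c₂ ≠ 0) : z ^ b ≠ algebraMap F E c₁ + algebraMap F E c₂ * z ^ a := by
  intro hab
  set N := (Nat.card E - 1) / (Nat.card F - 1)
  obtain ⟨i, -, hi⟩ := exists_lt_pow_eq_algebraMap hZ.isPrimitiveRoot hc₁
  obtain ⟨j, hj, hij⟩ := exists_lt_pow_eq_algebraMap hZ.isPrimitiveRoot (div_ne_zero hc₂ hc₁)
  have hfactor : z ^ b = z ^ (i * N) * (1 + z ^ ((a + j * N) % (Nat.card E - 1))) := by
    have : algebraMap F E c₁ ≠ 0 := by simpa using hc₁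
    rw [hab, hZ.pow_mod, pow_add, hi, hij, map_div₀]
    field_simp
  have hz0 : z ≠ 0 := hZ.isPrimitiveRoot.ne_zero card_sub_one_pos.ne'
  rcases hZ.one_add_pow _ (Nat.mod_lt (a + j * N) card_sub_one_pos) with h0 | hlog
  · rw [h0, mul_zero] at hfactor
    exact pow_ne_zero b hz0 hfactor
  · rw [hlog, ← pow_add] at hfactor
    have hmod : b ≡ i * N + Z ((a + j * N) % (Nat.card E - 1)) [MOD N] :=
      (hZ.modEq_of_pow_eq_pow hfactor).of_dvd
        (Nat.div_dvd_of_dvd card_sub_one_dvd_card_sub_one)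
    simp only [checkTriple, force_eq, List.all_eq_true, List.mem_range, bne_iff_ne] at h
    refine h j hj (Eq.symm ?_)
    simpa [Nat.ModEq] using hmod

theorem isArcExponent_of_checkExponent (hZ : IsZechLog z Z) {p : ℕ} [Fact p.Prime] [CharP E p]
    {e w n k : ℕ} (hw : w.Coprime (Nat.card E - 1)) (hk : Nat.card E - 1 ≤ 2 ^ k)
    (h : checkExponent p e (Nat.card E - 1) (Nat.card F - 1) w n k Z = true) {i : ℕ} (hi : i < n) :
    IsArcExponent F E (w ^ (i + 1)) := by
  have hz := hZ.isPrimitiveRoot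
  refine isArcExponent_of_minimal_in_orbit hz p fun t ht hrange hmin =>
    one_add_pow_notMem_span (hw.pow_left _) hrange fun a b ha hb => ?_
  have hcheck := forall_of_allBlock h (Nat.zero_le t) (by omega)
  simp only [Bool.or_eq_true, decide_eq_true_eq, beq_iff_eq, Bool.not_eq_true',
    isOrbitMin_eq_true hmin, ht.not_ge, false_or, Bool.true_eq_false, or_false] at hcheck
  replace hcheck := hcheck.resolve_left fun hdvd =>
    hrange (pow_mem_fieldRange_of_dvd hz (Nat.dvd_of_mod_eq_zero hdvd))
  have hne : 1 + z ^ t ≠ 0 := fun h0 =>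
    hrange (neg_eq_of_add_eq_zero_right h0 ▸ neg_mem (one_mem _))
  rw [(hZ.one_add_pow t ht).resolve_left hne]
  simpa only [hZ.pow_mod, pow_mul, pow_right_comm z _ (w ^ (i + 1)), mul_comm (w ^ (i + 1))] using
    hZ.pow_ne_of_checkTriple (checkTriple_of_checkPowers hcheck hi) ha hb

end IsZechLog

end ZechLogarithms

section Digits

/-- Digitwise `a + c * b` modulo `p`, on the lowest `n` base `p` digits of `a` and `b`. -/
def axpy (p c : ℕ) : ℕ → ℕ → ℕ → ℕ
  | 0, a, _ => a
  | n + 1, a, b => bif b == 0 then a else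
      (a + c * b) % p + p * force (a / p) fun a' => force (b / p) fun b' => axpy p c n a' b'

/-- Multiplication by the root `x` of `X ^ e - g`, where polynomials of degree less than `e` over
the prime field are encoded by the numbers whose base `p` digits are the coefficients. -/
def mulRoot (p e g a : ℕ) : ℕ :=
  force (p * a / p ^ e) fun c => force (p * a % p ^ e) fun b => axpy p c e b g

/-- Addition of the constant polynomial `1` in the encoding by base `p` digits. -/
def addOne (p a : ℕ) : ℕ := (a + 1) % p + p * (a / p)

/-- The value at `x` of the polynomial whose coefficients are the base `p` digits of `a`. -/
def digitValue {R : Type*} [CommRing R] (p : ℕ) (x : R) (a : ℕ) : R :=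
  Nat.ofDigits x (Nat.digits p a)

variable {R : Type*} [CommRing R] {p : ℕ}

theorem digitValue_zero (x : R) : digitValue p x 0 = 0 := by
  rw [digitValue, Nat.digits_zero]
  rfl

theorem digitValue_eq_mod_add_mul_div (hp : 1 < p) (x : R) (a : ℕ) :
    digitValue p x a = ((a % p : ℕ) : R) + x * digitValue p x (a / p) := by
  rcases Nat.eq_zero_or_pos a with rfl | ha
  · simp [digitValue_zero]
  · rw [digitValue, Nat.digits_def' hp ha]
    rfl

theorem digitValue_add_mul (hp : 1 < p) (x : R) {c : ℕ} (hc : c < p) (a : ℕ) :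
    digitValue p x (c + p * a) = c + x * digitValue p x a := by
  rw [digitValue_eq_mod_add_mul_div hp, Nat.add_mul_mod_self_left, Nat.mod_eq_of_lt hc,
    Nat.add_mul_div_left _ _ (by omega), Nat.div_eq_of_lt hc, zero_add]

theorem digitValue_of_lt (hp : 1 < p) (x : R) {c : ℕ} (hc : c < p) : digitValue p x c = c := by
  simpa [digitValue_zero] using digitValue_add_mul hp x hc 0

theorem digitValue_mul (hp : 1 < p) (x : R) (a : ℕ) :
    digitValue p x (p * a) = x * digitValue p x a := by
  simpa using digitValue_add_mul hp x (c := 0) (by omega) a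

theorem digitValue_eq_mod_pow_add_pow_mul_div (hp : 1 < p) (x : R) (n a : ℕ) :
    digitValue p x a = digitValue p x (a % p ^ n) + x ^ n * digitValue p x (a / p ^ n) := by
  induction n generalizing a with
  | zero => simp [Nat.mod_one, digitValue_zero]
  | succ n ih =>
    have hmod : a % p ^ (n + 1) = a % p + p * (a / p % p ^ n) := by
      rw [pow_succ', Nat.mod_mul]
    rw [hmod, digitValue_add_mul hp x (Nat.mod_lt _ (by omega)),
      digitValue_eq_mod_add_mul_div hp x a, ih (a / p), Nat.div_div_eq_div_mul, ← pow_succ']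
    ring

theorem map_digitValue {S : Type*} [CommRing S] (f : R →+* S) (x : R) (a : ℕ) :
    f (digitValue p x a) = digitValue p (f x) a := by
  unfold digitValue
  induction Nat.digits p a with
  | nil => exact map_zero f
  | cons c l ih =>
    change f (c + x * Nat.ofDigits x l) = c + f x * Nat.ofDigits (f x) l
    rw [map_add, map_mul, map_natCast, ih]

open Polynomial in
theorem degree_digitValue_X_lt (hp : 1 < p) {n a : ℕ} (ha : a < p ^ n) :
    (digitValue p (X : R[X]) a).degree < n := by
  induction n generalizing a with
  | zero =>
    obtain rfl : a = 0 := by simpa using ha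
    simp [digitValue_zero]
  | succ n ih =>
    have hdeg := ih (Nat.div_lt_of_lt_mul (by rwa [← pow_succ']) : a / p < p ^ n)
    rw [degree_lt_iff_coeff_zero] at hdeg ⊢
    intro i hi
    obtain ⟨i, rfl⟩ : ∃ j, i = j + 1 := ⟨i - 1, by omega⟩
    rw [digitValue_eq_mod_add_mul_div hp, coeff_add, coeff_X_mul, hdeg i (by omega),
      coeff_natCast_ite, if_neg (by omega), Nat.cast_zero, add_zero]

theorem cast_mod_of_cast_eq_zero (h0 : (p : R) = 0) (a : ℕ) : ((a % p : ℕ) : R) = a := by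
  conv_rhs => rw [← Nat.mod_add_div a p]
  simp [h0]

theorem digitValue_axpy (hp : 1 < p) (h0 : (p : R) = 0) (x : R) (c : ℕ) {n : ℕ} (a : ℕ) {b : ℕ}
    (hb : b < p ^ n) :
    digitValue p x (axpy p c n a b) = digitValue p x a + c * digitValue p x b := by
  induction n generalizing a b with
  | zero =>
    obtain rfl : b = 0 := by simpa using hb
    simp [axpy, digitValue_zero]
  | succ n ih =>
    rcases eq_or_ne b 0 with rfl | hb0
    · simp [axpy, digitValue_zero]
    have haxpy : axpy p c (n + 1) a b = (a + c * b) % p + p * axpy p c n (a / p) (b / p) := by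
      rw [axpy, force_eq, force_eq, beq_false_of_ne hb0, cond_false]
    rw [haxpy, digitValue_add_mul hp x (Nat.mod_lt _ (by omega)),
      ih _ (Nat.div_lt_of_lt_mul (by rwa [← pow_succ'])), digitValue_eq_mod_add_mul_div hp x a,
      digitValue_eq_mod_add_mul_div hp x b, cast_mod_of_cast_eq_zero h0,
      cast_mod_of_cast_eq_zero h0, cast_mod_of_cast_eq_zero h0]
    push_cast
    ring

theorem digitValue_mulRoot (hp : 1 < p) (h0 : (p : R) = 0) {e g : ℕ} (hg : g < p ^ e) {x : R}
    (hx : x ^ e = digitValue p x g) {a : ℕ} (ha : a < p ^ e) :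
    digitValue p x (mulRoot p e g a) = x * digitValue p x a := by
  have hlt : p * a / p ^ e < p :=
    Nat.div_lt_of_lt_mul (by rw [mul_comm]; exact Nat.mul_lt_mul_of_pos_right ha (by omega))
  rw [mulRoot, force_eq, force_eq, digitValue_axpy hp h0 x _ _ hg, ← hx, ← digitValue_mul hp,
    digitValue_eq_mod_pow_add_pow_mul_div hp x e (p * a), digitValue_of_lt hp x hlt,
    mul_comm (x ^ e)]

theorem digitValue_addOne (hp : 1 < p) (h0 : (p : R) = 0) (x : R) (a : ℕ) :
    digitValue p x (addOne p a) = 1 + digitValue p x a := by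
  rw [addOne, digitValue_add_mul hp x (Nat.mod_lt _ (by omega)),
    digitValue_eq_mod_add_mul_div hp x a, cast_mod_of_cast_eq_zero h0, cast_mod_of_cast_eq_zero h0]
  push_cast
  ring

end Digits

section ZechTables

/-- `P` lists the powers of a root of `X ^ e - g`, in the encoding by base `p` digits, up to the
exponent `p ^ e - 1`, where they return to `1`; `Z` lists the Zech logarithms, except at the
logarithm `h` of `-1`. -/
structure IsZechTable (p e g h : ℕ) (P Z : ℕ → ℕ) : Prop where
  lt_pow : g < p ^ e
  log_neg_one_lt : h < p ^ e - 1
  zero : P 0 = 1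
  last : P (p ^ e - 1) = 1
  add_one_log_neg_one : addOne p (P h) = 0
  lt : ∀ t < p ^ e - 1, P t < p ^ e
  succ : ∀ t < p ^ e - 1, P (t + 1) = mulRoot p e g (P t)
  zech_lt : ∀ t < p ^ e - 1, t ≠ h → Z t < p ^ e
  zech : ∀ t < p ^ e - 1, t ≠ h → P (Z t) = addOne p (P t)

/-- The test of `IsZechTable` for tables of `2 ^ k` entries. -/
def checkZech (p e g h k : ℕ) (P Z : ℕ → ℕ) : Bool :=
  force (p ^ e - 1) fun m =>
  g ≤ m && h < m && P 0 == 1 && P m == 1 && addOne p (P h) == 0 &&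
  allBlock (fun t => m ≤ t || force (P t) fun a =>
    a ≤ m && P (t + 1) == mulRoot p e g a &&
    (t == h || force (Z t) fun u => u ≤ m && P u == addOne p a)) k 0

theorem isZechTable_of_checkZech {p e g h k : ℕ} {P Z : ℕ → ℕ} (hk : p ^ e - 1 ≤ 2 ^ k)
    (hcheck : checkZech p e g h k P Z = true) : IsZechTable p e g h P Z := by
  simp only [checkZech, force_eq, Bool.and_eq_true, decide_eq_true_eq, beq_iff_eq] at hcheck
  obtain ⟨⟨⟨⟨⟨hg, hh⟩, hzero⟩, hlast⟩, hneg⟩, hblock⟩ := hcheck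
  have hentry (t : ℕ) (ht : t < p ^ e - 1) := forall_of_allBlock hblock t.zero_le (by omega)
  simp only [Bool.or_eq_true, Bool.and_eq_true, decide_eq_true_eq, beq_iff_eq] at hentry
  replace hentry (t : ℕ) (ht : t < p ^ e - 1) := (hentry t ht).resolve_left ht.not_ge
  exact {
    lt_pow := by omega
    log_neg_one_lt := hh
    zero := hzero
    last := hlast
    add_one_log_neg_one := hneg
    lt t ht := by have := (hentry t ht).1.1; omega
    succ t ht := (hentry t ht).1.2
    zech_lt t ht hth := by have := ((hentry t ht).2.resolve_left hth).1; omega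
    zech t ht hth := ((hentry t ht).2.resolve_left hth).2 }

namespace IsZechTable

variable {p e g h : ℕ} {P Z : ℕ → ℕ}

section Ring

variable {R : Type*} [CommRing R] {x : R}

theorem digitValue_eq_pow (hT : IsZechTable p e g h P Z) (hp : 1 < p) (h0 : (p : R) = 0)
    (hx : x ^ e = digitValue p x g) {t : ℕ} (ht : t < p ^ e) : digitValue p x (P t) = x ^ t := by
  induction t with
  | zero => simpa [hT.zero] using digitValue_of_lt hp x hp
  | succ t ih =>
    have ht' : t < p ^ e - 1 := by omega
    rw [hT.succ t ht', digitValue_mulRoot hp h0 hT.lt_pow hx (hT.lt t ht'), ih (by omega),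
      pow_succ']

theorem pow_eq_one (hT : IsZechTable p e g h P Z) (hp : 1 < p) (h0 : (p : R) = 0)
    (hx : x ^ e = digitValue p x g) : x ^ (p ^ e - 1) = 1 := by
  rw [← hT.digitValue_eq_pow hp h0 hx (by have := hT.lt_pow; omega), hT.last,
    digitValue_of_lt hp x hp, Nat.cast_one]

theorem one_add_pow_log_neg_one (hT : IsZechTable p e g h P Z) (hp : 1 < p) (h0 : (p : R) = 0)
    (hx : x ^ e = digitValue p x g) : 1 + x ^ h = 0 := by
  rw [← hT.digitValue_eq_pow hp h0 hx (by have := hT.log_neg_one_lt; omega),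
    ← digitValue_addOne hp h0, hT.add_one_log_neg_one, digitValue_zero]

theorem one_add_pow_eq_pow (hT : IsZechTable p e g h P Z) (hp : 1 < p) (h0 : (p : R) = 0)
    (hx : x ^ e = digitValue p x g) {t : ℕ} (ht : t < p ^ e - 1) (hth : t ≠ h) :
    1 + x ^ t = x ^ Z t := by
  rw [← hT.digitValue_eq_pow hp h0 hx (by omega), ← digitValue_addOne hp h0, ← hT.zech t ht hth,
    hT.digitValue_eq_pow hp h0 hx (hT.zech_lt t ht hth)]

end Ring

theorem isPrimitiveRoot (hT : IsZechTable p e g h P Z) (hp : 1 < p) {E : Type*} [Field E]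
    (h0 : (p : E) = 0) {z : E} (hz : z ^ e = digitValue p z g) : IsPrimitiveRoot z (p ^ e - 1) := by
  have hh := hT.log_neg_one_lt
  have hone := hT.pow_eq_one hp h0 hz
  have hz0 : z ≠ 0 := by
    rintro rfl
    rw [zero_pow (by omega)] at hone
    exact zero_ne_one hone
  refine IsPrimitiveRoot.mk_of_lt z (by omega) hone fun l hl0 hl hzl => ?_
  -- Otherwise `-1` would have a second logarithm `h + l`, at which `1 + z ^ t` is a power of `z`.
  have hne : (h + l) % (p ^ e - 1) ≠ h := by
    intro heq
    rcases lt_or_ge (h + l) (p ^ e - 1) with hlt | hge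
    · rw [Nat.mod_eq_of_lt hlt] at heq
      omega
    · rw [Nat.mod_eq_sub_mod hge, Nat.mod_eq_of_lt (by omega)] at heq
      omega
  have hzech := hT.one_add_pow_eq_pow hp h0 hz (Nat.mod_lt _ (by omega)) hne
  rw [← pow_eq_pow_mod _ hone, pow_add, hzl, mul_one, hT.one_add_pow_log_neg_one hp h0 hz] at hzech
  exact pow_ne_zero _ hz0 hzech.symm

open Polynomial in
theorem dvd_X_pow_sub_one (hT : IsZechTable p e g h P Z) (hp : 1 < p) {R : Type*} [CommRing R]
    (h0 : (p : R) = 0) : (X ^ e - digitValue p X g : R[X]) ∣ X ^ (p ^ e - 1) - 1 := by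
  rw [← AdjoinRoot.mk_eq_zero, map_sub, map_pow, map_one, sub_eq_zero]
  refine hT.pow_eq_one hp ?_ ?_
  · rw [← map_natCast (AdjoinRoot.of _), h0, map_zero]
  · rw [← map_digitValue, ← map_pow, ← sub_eq_zero, ← map_sub, AdjoinRoot.mk_self]

open Polynomial in
theorem exists_pow_eq_digitValue (hT : IsZechTable p e g h P Z) (hp : 1 < p) {E : Type*} [Field E]
    [Finite E] (h0 : (p : E) = 0) (hE : Nat.card E = p ^ e) :
    ∃ z : E, z ^ e = digitValue p z g := by
  have hdvd : (X ^ e - digitValue p X g : E[X]) ∣ X ^ Nat.card E - X := by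
    refine (hT.dvd_X_pow_sub_one hp h0).trans ⟨X, ?_⟩
    rw [sub_mul, one_mul, ← hE, pow_sub_one_mul Finite.card_pos.ne']
  have hsplits : (X ^ e - digitValue p X g : E[X]).Splits :=
    (splits_X_pow_card_sub_X E).of_dvd
      (FiniteField.X_pow_card_sub_X_ne_zero E Finite.one_lt_card) hdvd
  have hdegree : (X ^ e - digitValue p X g : E[X]).degree = e := by
    rw [degree_sub_eq_left_of_degree_lt, degree_X_pow]
    rw [degree_X_pow]
    exact degree_digitValue_X_lt hp hT.lt_pow
  have he : e ≠ 0 := by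
    rintro rfl
    exact hT.log_neg_one_lt.not_ge (by simp)
  obtain ⟨z, hz⟩ := hsplits.exists_eval_eq_zero (by rw [hdegree]; exact_mod_cast he)
  have heval := map_digitValue (p := p) (evalRingHom z) X g
  rw [coe_evalRingHom, eval_X] at heval
  exact ⟨z, by rwa [eval_sub, eval_pow, eval_X, heval, sub_eq_zero] at hz⟩

theorem exists_isZechLog (hT : IsZechTable p e g h P Z) (hp : 1 < p) {E : Type*} [Field E]
    [Finite E] (h0 : (p : E) = 0) (hE : Nat.card E = p ^ e) : ∃ z : E, IsZechLog z Z := by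
  obtain ⟨z, hz⟩ := hT.exists_pow_eq_digitValue hp h0 hE
  refine ⟨z, hE ▸ hT.isPrimitiveRoot hp h0 hz, fun t ht => ?_⟩
  rw [hE] at ht
  rcases eq_or_ne t h with rfl | hth
  · exact Or.inl (hT.one_add_pow_log_neg_one hp h0 hz)
  · exact Or.inr (hT.one_add_pow_eq_pow hp h0 hz ht hth)

end IsZechTable

end ZechTables

section Certificates

/-- The entry with index `i` of a table stored in the number `T` with `k` bits for each entry. -/
def entry (k T i : ℕ) : ℕ := T >>> (k * i) % 2 ^ k

/-- The table of the `2 ^ j` iterates `a, f a, f (f a), …`. -/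
def iterateTable (k : ℕ) (f : ℕ → ℕ) : ℕ → ℕ → ℕ
  | 0, a => a
  | j + 1, a => force (iterateTable k f j a) fun T =>
      T + force (f (entry k T (2 ^ j - 1))) (iterateTable k f j) <<< (k * 2 ^ j)

/-- The sum of `f t` over `lo ≤ t < lo + 2 ^ j`, by halving the interval as in `allBlock`. -/
def sumBlock (f : ℕ → ℕ) : ℕ → ℕ → ℕ
  | 0, lo => f lo
  | j + 1, lo => sumBlock f j lo + force (lo + 2 ^ j) (sumBlock f j)

/-- The table whose entry with index `a` is the `t < m` such that `T` has the entry `a` with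
index `t`. -/
def inverseTable (k m T : ℕ) : ℕ :=
  sumBlock (fun t => bif m ≤ t then 0 else t <<< (k * entry k T t)) k 0

/-- The test that `Φ_{w ^ i}(S)` with `i < n` are mutually orthogoval spaces `PG(d, q)`, where
`q = p ^ s` and `z` is a root of `X ^ (s * (d + 1)) - g`, with `g` a polynomial over the prime field
in the encoding by base `p` digits. Nothing is proved about `iterateTable` and `inverseTable`:
`checkZech` verifies the tables they compute. -/
def checkOrthogoval (p s d g w n : ℕ) : Bool :=
  force (s * (d + 1)) fun e => force (p ^ e - 1) fun m => force (m.log2 + 1) fun k =>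
  force (p ^ s - 1) fun r => force (iterateTable k (mulRoot p e g) k 1) fun T =>
  force (inverseTable k m T) fun L => force (entry k L (p - 1)) fun h =>
    let P := entry k T
    let Z := fun t => entry k L (addOne p (entry k T t))
    w.gcd m == 1 && checkZech p e g h k P Z && checkExponent p e m r w (n - 1) k Z

theorem hasMutuallyOrthogovalPG_of_checkOrthogoval.{u} {p s d g w n : ℕ} (hp : p.Prime)
    {F : Type u} [Field F] (hF : Nat.card F = p ^ s) (hd : 0 < d)
    (hcheck : checkOrthogoval p s d g w n = true) : HasMutuallyOrthogovalPG d F n := by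
  simp only [checkOrthogoval, force_eq, Bool.and_eq_true, beq_iff_eq] at hcheck
  obtain ⟨⟨hw, hzech⟩, harc⟩ := hcheck
  have : Fact p.Prime := ⟨hp⟩
  have : Finite F := Nat.finite_of_card_ne_zero (hF ▸ (pow_pos hp.pos s).ne')
  have : CharP F p := by
    have := Fintype.ofFinite F
    exact charP_of_card_eq_prime_pow (f := s) (by rw [Fintype.card_eq_nat_card, hF])
  let E := ULift.{u} (FiniteField.Extension F p (d + 1))
  have hrank : Module.finrank F E = d + 1 := by
    rw [(ULift.algEquiv (R := F)).toLinearEquiv.finrank_eq]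
    exact FiniteField.finrank_extension F p (d + 1)
  have : CharP E p := charP_of_injective_algebraMap (algebraMap F E).injective p
  have : Module.Finite F E := Module.finite_of_finrank_eq_succ hrank
  have : Finite E := Module.finite_of_finite F
  have hE : Nat.card E = p ^ (s * (d + 1)) := by
    rw [Module.natCard_eq_pow_finrank (K := F), hrank, hF, ← pow_mul]
  have hbits := (Nat.lt_log2_self (n := p ^ (s * (d + 1)) - 1)).le
  obtain ⟨z, hZ⟩ :=
    (isZechTable_of_checkZech hbits hzech).exists_isZechLog hp.one_lt (CharP.cast_eq_zero E p) hE
  replace hw : w.Coprime (Nat.card E - 1) := hE ▸ hw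
  refine hasMutuallyOrthogovalPG_of_isArcExponent hd hZ.isPrimitiveRoot hrank hw fun i hi hin => ?_
  obtain ⟨i, rfl⟩ := Nat.exists_eq_succ_of_ne_zero hi.ne'
  rw [← hF] at harc
  exact hZ.isArcExponent_of_checkExponent hw (hE ▸ hbits) (by rw [hE]; exact harc) (by omega)

end Certificates

section OrthogovalSets

variable {F : Type*} [Field F]

theorem hasMutuallyOrthogovalPG_four_two (hF : Nat.card F = 2) :
    HasMutuallyOrthogovalPG 4 F 6 :=
  hasMutuallyOrthogovalPG_of_checkOrthogoval (p := 2) (s := 1) (g := 5) (w := 3) (by decide) hF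
    (by decide) (by decide +kernel)

theorem hasMutuallyOrthogovalPG_six_two (hF : Nat.card F = 2) :
    HasMutuallyOrthogovalPG 6 F 18 :=
  hasMutuallyOrthogovalPG_of_checkOrthogoval (p := 2) (s := 1) (g := 3) (w := 3) (by decide) hF
    (by decide) (by decide +kernel)

theorem hasMutuallyOrthogovalPG_four_three (hF : Nat.card F = 3) :
    HasMutuallyOrthogovalPG 4 F 10 :=
  hasMutuallyOrthogovalPG_of_checkOrthogoval (p := 3) (s := 1) (g := 5) (w := 17) (by decide) hF
    (by decide) (by decide +kernel)

theorem hasMutuallyOrthogovalPG_six_three (hF : Nat.card F = 3) :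
    HasMutuallyOrthogovalPG 6 F 78 :=
  hasMutuallyOrthogovalPG_of_checkOrthogoval (p := 3) (s := 1) (g := 23) (w := 25) (by decide) hF
    (by decide) (by decide +kernel)

theorem hasMutuallyOrthogovalPG_four_four (hF : Nat.card F = 4) :
    HasMutuallyOrthogovalPG 4 F 3 :=
  hasMutuallyOrthogovalPG_of_checkOrthogoval (p := 2) (s := 2) (g := 9) (w := 7) (by decide) hF
    (by decide) (by decide +kernel)

theorem hasMutuallyOrthogovalPG_six_four (hF : Nat.card F = 4) :
    HasMutuallyOrthogovalPG 6 F 11 :=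
  hasMutuallyOrthogovalPG_of_checkOrthogoval (p := 2) (s := 2) (g := 43) (w := 23) (by decide) hF
    (by decide) (by decide +kernel)

theorem hasMutuallyOrthogovalPG_four_five (hF : Nat.card F = 5) :
    HasMutuallyOrthogovalPG 4 F 7 :=
  hasMutuallyOrthogovalPG_of_checkOrthogoval (p := 5) (s := 1) (g := 8) (w := 3) (by decide) hF
    (by decide) (by decide +kernel)

end OrthogovalSets

end Orthogoval

theorem mainTheorem11 (F : Type*) [Field F] :
    (Nat.card F = 2 →
      Orthogoval.HasMutuallyOrthogovalPG 4 F 6 ∧ Orthogoval.HasMutuallyOrthogovalPG 6 F 18) ∧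
    (Nat.card F = 3 →
      Orthogoval.HasMutuallyOrthogovalPG 4 F 10 ∧ Orthogoval.HasMutuallyOrthogovalPG 6 F 78) ∧
    (Nat.card F = 4 →
      Orthogoval.HasMutuallyOrthogovalPG 4 F 3 ∧ Orthogoval.HasMutuallyOrthogovalPG 6 F 11) ∧
    (Nat.card F = 5 → Orthogoval.HasMutuallyOrthogovalPG 4 F 7) := by
  open Orthogoval in
  exact
    ⟨fun h => ⟨hasMutuallyOrthogovalPG_four_two h, hasMutuallyOrthogovalPG_six_two h⟩,
      fun h => ⟨hasMutuallyOrthogovalPG_four_three h, hasMutuallyOrthogovalPG_six_three h⟩,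
      fun h => ⟨hasMutuallyOrthogovalPG_four_four h, hasMutuallyOrthogovalPG_six_four h⟩,
      hasMutuallyOrthogovalPG_four_five⟩
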